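/- **Theorem 3.2 (The Cardinality Theorem).** Let $G$ be a compact Lie group of dimension $d$ and let $V$ be a real vector space of finite dimension $n>d$ on which $G$ acts linearly and continuously. A function $f:V\to\mathbb R$ is called invariant if $f(g\cdot v)=f(v)$ for all $g\in G$ and $v\in V$. A set $S$ of invariant functions is called a function basis if every invariant function $f:V\to\mathbb R$ can be expressed as a function of the elements of $S$, i.e. there is a function $F:\mathbb R^{S}\to\mathbb R$ with $f(v)=F\big((p(v))_{p\in S}\big)$ for all $v\in V$. Then every function basis $S$ all of whose elements are polynomial functions on $V$ has at least $n-d$ elements. -/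

import Mathlib

open scoped Manifold ContDiff

/-- The algebra `ℝ[V]` of polynomial functions on a real vector space `V`: the algebra of real
functions on `V` generated by the linear forms. (As `ℝ` is infinite, polynomials and polynomial
functions on a finite-dimensional `V` are the same thing.) -/
def polyFun (V : Type*) [AddCommGroup V] [Module ℝ V] : Subalgebra ℝ (V → ℝ) :=
  Algebra.adjoin ℝ {f : V → ℝ | ∃ φ : Module.Dual ℝ V, ∀ v, f v = φ v}

/-- A function `f : V → ℝ` is an invariant of the representation `ρ` if `f (g • v) = f v` for all
`g` and `v`. -/
def IsInvariantFun {G V : Type*} [Group G] [AddCommGroup V] [Module ℝ V]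
    (ρ : Representation ℝ G V) (f : V → ℝ) : Prop :=
  ∀ (g : G) (v : V), f (ρ g v) = f v

/-- The algebra `ℝ[V]^G` of polynomial invariants of the representation `ρ`. -/
def polyInvariants {G V : Type*} [Group G] [AddCommGroup V] [Module ℝ V]
    (ρ : Representation ℝ G V) : Subalgebra ℝ (V → ℝ) where
  carrier := {f | f ∈ polyFun V ∧ IsInvariantFun ρ f}
  mul_mem' := fun ha hb => ⟨mul_mem ha.1 hb.1, fun g v => by
    simp only [Pi.mul_apply, ha.2 g v, hb.2 g v]⟩
  add_mem' := fun ha hb => ⟨add_mem ha.1 hb.1, fun g v => by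
    simp only [Pi.add_apply, ha.2 g v, hb.2 g v]⟩
  algebraMap_mem' := fun r => ⟨(polyFun V).algebraMap_mem r, fun _ _ => rfl⟩

/-- A set `S` of invariants is a function basis if every invariant function `f : V → ℝ` can be
expressed as a function of the elements of `S`, that is, `f v = F ((p v)_{p ∈ S})` for some real
function `F` of `S`-indexed real tuples. -/
def IsFunctionBasis {G V : Type*} [Group G] [AddCommGroup V] [Module ℝ V]
    (ρ : Representation ℝ G V) (S : Set (V → ℝ)) : Prop :=
  (∀ p ∈ S, IsInvariantFun ρ p) ∧
    ∀ f : V → ℝ, IsInvariantFun ρ f →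
      ∃ F : (S → ℝ) → ℝ, ∀ v : V, f v = F (fun p => (p : V → ℝ) v)

/-- A polynomial function basis: a function basis consisting of polynomial invariants. -/
def IsPolynomialFunctionBasis {G V : Type*} [Group G] [AddCommGroup V] [Module ℝ V]
    (ρ : Representation ℝ G V) (S : Set (V → ℝ)) : Prop :=
  S ⊆ (polyInvariants ρ : Set (V → ℝ)) ∧ IsFunctionBasis ρ S

/-! A function basis separates orbits: the indicator of an orbit is invariant, hence a function of
the elements of `S`. So every common fibre of `S` lies in one orbit. Dimensions are compared through
`dimH`. If `S` has `m` elements, the constant rank argument at a point of maximal rank gives a fibre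
of dimension at least `n - m` (`exists_finrank_le_dimH_fiber`). Orbits have dimension at most `d`
(`dimH_orbit_le`), since orbit maps are locally Lipschitz; this follows from continuity of the
action by averaging over Haar measure. Hence `n ≤ d + m`. -/

/-! ### Large fibres of `C^1` families -/

open Set Filter Topology Module in
theorem surjective_pi_of_linearIndependent {W ι : Type*} [NormedAddCommGroup W] [NormedSpace ℝ W]
    [Fintype ι] {A : ι → W →L[ℝ] ℝ} (hA : LinearIndependent ℝ A) :
    Function.Surjective (ContinuousLinearMap.pi A) := by
  classical
  by_contra h
  have hlt : LinearMap.range (ContinuousLinearMap.pi A).toLinearMap < ⊤ :=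
    lt_top_iff_ne_top.2 fun h' => h (LinearMap.range_eq_top.1 h')
  -- The coordinates of a functional vanishing on the range are the coefficients of a linear
  -- relation among the `A i`.
  obtain ⟨f, hf0, hf⟩ := Submodule.exists_le_ker_of_lt_top _ hlt
  apply hf0
  have hsum : ∀ x : ι → ℝ, f x = ∑ i, f (Pi.single i 1) * x i := by
    intro x
    conv_lhs => rw [LinearMap.pi_apply_eq_sum_univ f x]
    refine Finset.sum_congr rfl fun i _ => ?_
    rw [smul_eq_mul, mul_comm]
    congr 2
    ext j
    simp [Pi.single_apply, eq_comm]
  have hzero : ∑ i, f (Pi.single i 1) • A i = 0 := by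
    ext w
    have : f (ContinuousLinearMap.pi A w) = 0 := hf ⟨w, rfl⟩
    rw [hsum] at this
    simpa using this
  have := Fintype.linearIndependent_iff.1 hA _ hzero
  ext i
  simpa using this i

open Set Filter Topology Module in
/-- A point at which the fibre of a `C^1` family of `card ι` functions has Hausdorff dimension at
least `finrank W - card ι`. -/
theorem exists_finrank_le_dimH_fiber {W ι : Type*} [NormedAddCommGroup W] [NormedSpace ℝ W]
    [FiniteDimensional ℝ W] [Fintype ι] {p : ι → W → ℝ} (hp : ∀ i, ContDiff ℝ 1 (p i)) :
    ∃ v₀ : W, (finrank ℝ W : ENNReal) ≤ dimH {w | ∀ i, p i w = p i v₀} + Fintype.card ι := by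
  classical
  let D : W → ι → W →L[ℝ] ℝ := fun v i => fderiv ℝ (p i) v
  let r : W → ℕ := fun v => finrank ℝ (Submodule.span ℝ (range (D v)))
  have hrle : ∀ v, r v ≤ Fintype.card ι := fun v => finrank_range_le_card (D v)
  -- The rank is lower semicontinuous, so it is constant near a point where it is maximal.
  obtain ⟨v₀, hv₀⟩ : ∃ v₀, ∀ v, r v ≤ r v₀ := by
    have hfin : (range r).Finite :=
      (Set.finite_Iic (Fintype.card ι)).subset (by rintro _ ⟨v, rfl⟩; exact hrle v)
    obtain ⟨m, ⟨v, rfl⟩, hm⟩ := hfin.exists_maximal (range_nonempty r)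
    refine ⟨v, fun w => ?_⟩
    rcases le_total (r w) (r v) with h | h
    · exact h
    · exact hm ⟨w, rfl⟩ h
  refine ⟨v₀, ?_⟩
  obtain ⟨κ, a, ha, hspan, hli⟩ := exists_linearIndependent' ℝ (D v₀)
  have : Finite κ := Finite.of_injective a ha
  have : Fintype κ := Fintype.ofFinite κ
  have hcard : Fintype.card κ = r v₀ := by
    rw [← finrank_span_eq_card hli, hspan]
  have hDcont : ∀ i, Continuous fun v => D v i := fun i => (hp i).continuous_fderiv one_ne_zero
  -- near `v₀`, every derivative is a combination of the selected ones
  have hnear : ∀ᶠ v in 𝓝 v₀, ∀ i, D v i ∈ Submodule.span ℝ (range (D v ∘ a)) := by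
    have hopen : ∀ᶠ v in 𝓝 v₀, LinearIndependent ℝ (D v ∘ a) := by
      have hc : Continuous fun v => D v ∘ a := continuous_pi fun k => hDcont (a k)
      exact hc.continuousAt.eventually (isOpen_setOfPred_linearIndependent.mem_nhds hli)
    filter_upwards [hopen] with v hv i
    have hle : Submodule.span ℝ (range (D v ∘ a)) ≤ Submodule.span ℝ (range (D v)) :=
      Submodule.span_mono (range_comp_subset_range _ _)
    have heq := Submodule.eq_of_le_of_finrank_le hle (by
      rw [finrank_span_eq_card hv, hcard]; exact hv₀ v)
    rw [heq]
    exact Submodule.subset_span ⟨i, rfl⟩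
  let A : W →L[ℝ] (κ → ℝ) := ContinuousLinearMap.pi (D v₀ ∘ a)
  have hAsurj : Function.Surjective A := surjective_pi_of_linearIndependent hli
  let K := A.ker
  obtain ⟨π, hπ⟩ := A.ker_closedComplemented_of_finiteDimensional_range
  let T : W →L[ℝ] (κ → ℝ) × K := A.prod π
  have hTinj : Function.Injective T := by
    rw [injective_iff_map_eq_zero]
    intro x hx
    have h1 : A x = 0 := congrArg Prod.fst hx
    have h2 : π x = 0 := congrArg Prod.snd hx
    have h3 := hπ ⟨x, h1⟩
    rw [h2] at h3
    exact (congrArg Subtype.val h3).symm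
  have hrank : Fintype.card κ + finrank ℝ K = finrank ℝ W := by
    have := LinearMap.finrank_range_add_finrank_ker A.toLinearMap
    rw [LinearMap.range_eq_top.2 hAsurj, finrank_top, finrank_fintype_fun_eq_card] at this
    exact this
  let e : W ≃L[ℝ] (κ → ℝ) × K :=
    (LinearEquiv.ofInjectiveOfFinrankEq T.toLinearMap hTinj (by
      rw [finrank_prod, finrank_fintype_fun_eq_card, hrank])).toContinuousLinearEquiv
  have heT : (e : W →L[ℝ] (κ → ℝ) × K) = T := by
    ext x <;> rfl
  -- A local coordinate system: the selected functions, completed by a projection onto the kernel of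
  -- their differentials. Below, `ψ` is its inverse on the slice where the selected functions keep
  -- their values at `v₀`.
  let Φ : W → (κ → ℝ) × K := fun v => (fun k => p (a k) v, π v)
  have hΦ : ContDiff ℝ 1 Φ := (contDiff_pi.2 fun k => hp (a k)).prodMk π.contDiff
  have hΦ' : HasFDerivAt Φ (e : W →L[ℝ] (κ → ℝ) × K) v₀ := by
    rw [heT]
    refine HasFDerivAt.prodMk ?_ π.hasFDerivAt
    exact hasFDerivAt_pi.2 fun k => ((hp (a k)).differentiable one_ne_zero v₀).hasFDerivAt
  have hΦat : ContDiffAt ℝ 1 Φ v₀ := hΦ.contDiffAt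
  let χ := hΦat.localInverse hΦ' one_ne_zero
  have hχ : ContDiffAt ℝ 1 χ (Φ v₀) := hΦat.to_localInverse hΦ' one_ne_zero
  have hχ₀ : χ (Φ v₀) = v₀ := hΦat.localInverse_apply_image hΦ' one_ne_zero
  have hright : ∀ᶠ y in 𝓝 (Φ v₀), Φ (χ y) = y :=
    (hΦat.hasStrictFDerivAt' hΦ' one_ne_zero).eventually_right_inverse
  let j : K → (κ → ℝ) × K := fun t => ((Φ v₀).1, t)
  have hj : ContDiff ℝ 1 j := contDiff_const.prodMk contDiff_id
  let ψ : K → W := fun t => χ (j t)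
  have hψ : ContDiffAt ℝ 1 ψ (π v₀) := ContDiffAt.comp (π v₀) hχ hj.contDiffAt
  have hψ₀ : ψ (π v₀) = v₀ := hχ₀
  have hev : ∀ᶠ t in 𝓝 (π v₀), DifferentiableAt ℝ ψ t ∧ Φ (ψ t) = j t ∧
      ∀ i, D (ψ t) i ∈ Submodule.span ℝ (range (D (ψ t) ∘ a)) := by
    have hd : ∀ᶠ t in 𝓝 (π v₀), ContDiffAt ℝ 1 ψ t := hψ.eventually (by simp)
    have hr : ∀ᶠ t in 𝓝 (π v₀), Φ (χ (j t)) = j t := hj.continuous.continuousAt.eventually hright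
    have hn : ∀ᶠ t in 𝓝 (π v₀), ∀ i, D (ψ t) i ∈ Submodule.span ℝ (range (D (ψ t) ∘ a)) := by
      have ht : Tendsto ψ (𝓝 (π v₀)) (𝓝 v₀) := by
        simpa only [hψ₀] using hψ.continuousAt.tendsto
      exact ht.eventually hnear
    filter_upwards [hd, hr, hn] with t h1 h2 h3
    exact ⟨h1.differentiableAt one_ne_zero, h2, h3⟩
  obtain ⟨ε, hε, hball⟩ := Metric.eventually_nhds_iff_ball.1 hev
  have hmem : π v₀ ∈ Metric.ball (π v₀) ε := Metric.mem_ball_self hε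
  have hconst : ∀ i, ∀ t ∈ Metric.ball (π v₀) ε, p i (ψ t) = p i v₀ := by
    intro i t ht
    have hder : ∀ i, ∀ s ∈ Metric.ball (π v₀) ε,
        HasFDerivAt (fun t => p i (ψ t)) ((D (ψ s) i).comp (fderiv ℝ ψ s)) s := fun i s hs =>
      ((hp i).differentiable one_ne_zero (ψ s)).hasFDerivAt.comp s (hball s hs).1.hasFDerivAt
    -- Each differential is a combination of the selected ones, and these vanish along the slice.
    have hzero : ∀ s ∈ Metric.ball (π v₀) ε, fderiv ℝ (fun t => p i (ψ t)) s = 0 := by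
      intro s hs
      rw [(hder i s hs).fderiv]
      refine Submodule.span_induction (p := fun L _ => L.comp (fderiv ℝ ψ s) = 0) ?_ ?_ ?_ ?_
        ((hball s hs).2.2 i)
      · rintro _ ⟨k, rfl⟩
        have hc : (fun t => p (a k) (ψ t)) =ᶠ[𝓝 s] fun _ => p (a k) v₀ := by
          filter_upwards [Metric.isOpen_ball.mem_nhds hs] with u hu
          exact congrFun (congrArg Prod.fst (hball u hu).2.1) k
        rw [Function.comp_apply, ← (hder (a k) s hs).fderiv, hc.fderiv_eq]
        simp
      · exact ContinuousLinearMap.zero_comp _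
      · intro L M _ _ hL hM
        rw [ContinuousLinearMap.add_comp, hL, hM, add_zero]
      · intro c L _ hL
        rw [ContinuousLinearMap.smul_comp, hL, smul_zero]
    have := Metric.isOpen_ball.is_const_of_fderiv_eq_zero (𝕜 := ℝ)
      (convex_ball (π v₀) ε).isPreconnected
      (fun s hs => (hder i s hs).differentiableAt.differentiableWithinAt) hzero ht hmem
    rw [this, hψ₀]
  -- The Lipschitz map `π` sends the fibre onto a set containing a ball of `K`, which bounds the
  -- fibre's dimension from below.
  have hsub : Metric.ball (π v₀) ε ⊆ π '' {w | ∀ i, p i w = p i v₀} := fun t ht =>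
    ⟨ψ t, fun i => hconst i t ht, congrArg Prod.snd (hball t ht).2.1⟩
  have hdim : (finrank ℝ K : ENNReal) ≤ dimH {w | ∀ i, p i w = p i v₀} := by
    rw [← Real.dimH_of_mem_nhds (Metric.ball_mem_nhds (π v₀) hε)]
    exact (dimH_mono hsub).trans (π.lipschitz.dimH_image_le _)
  rw [← hrank, Nat.cast_add, add_comm]
  exact add_le_add hdim (Nat.cast_le.2 (hcard ▸ hrle v₀))

/-! ### Hausdorff dimension of orbits -/

-- Inseparable points lie in a common chart and have the same image in the Hausdorff model space, so
-- `G` is T0; a T0 topological group is Hausdorff.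
open Topology in
theorem t2Space_of_lieGroup {E : Type*} [NormedAddCommGroup E] [NormedSpace ℝ E]
    {H : Type*} [TopologicalSpace H] (I : ModelWithCorners ℝ E H)
    {G : Type*} [Group G] [TopologicalSpace G] [ChartedSpace H G] [LieGroup I ∞ G] :
    T2Space G := by
  have : IsTopologicalGroup G := topologicalGroup_of_lieGroup I ∞
  have hH : T2Space H := .of_injective_continuous I.injective I.continuous
  have : T0Space G := by
    refine ⟨fun x y hxy => ?_⟩
    have hy : y ∈ (chartAt H x).source :=
      (hxy.mem_open_iff (chartAt H x).open_source).1 (mem_chart_source H x)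
    refine (chartAt H x).injOn (mem_chart_source H x) hy ?_
    by_contra hne
    obtain ⟨U, V, hU, hV, hxU, hyV, hUV⟩ := t2_separation hne
    have hopen := (chartAt H x).isOpen_inter_preimage hU
    exact Set.disjoint_left.1 hUV ((hxy.mem_open_iff hopen).1 ⟨mem_chart_source H x, hxU⟩).2 hyV
  infer_instance

open Topology Filter in
/-- The left translates of a smooth function on a compact Lie group are uniformly Lipschitz in the
translating element, in the chart at the identity. -/
theorem exists_lipschitzOnWith_translate {E : Type*} [NormedAddCommGroup E] [NormedSpace ℝ E]
    {H : Type*} [TopologicalSpace H] (I : ModelWithCorners ℝ E H) [I.Boundaryless]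
    {G : Type*} [Group G] [TopologicalSpace G] [ChartedSpace H G] [LieGroup I ∞ G]
    [CompactSpace G] {φ : G → ℝ} (hφ : ContMDiff I 𝓘(ℝ, ℝ) ∞ φ) :
    ∃ C : NNReal, ∃ N ∈ 𝓝 (extChartAt I (1 : G) 1), ∀ g : G,
      LipschitzOnWith C (fun y => φ (((extChartAt I (1 : G)).symm y)⁻¹ * g)) N := by
  have hsymm : ∀ g : G, ContMDiffAt 𝓘(ℝ, E) I ∞ (extChartAt I g).symm (extChartAt I g g) :=
    fun g => (contMDiffOn_extChartAt_symm g).contMDiffAt (extChartAt_target_mem_nhds g)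
  -- Joint smoothness makes the constant uniform for `g` near `g₀`; compactness then leaves finitely
  -- many constants.
  have hloc : ∀ g₀ : G, ∃ C : NNReal, ∃ N ∈ 𝓝 (extChartAt I (1 : G) 1), ∃ M ∈ 𝓝 g₀, ∀ g ∈ M,
      LipschitzOnWith C (fun y => φ (((extChartAt I (1 : G)).symm y)⁻¹ * g)) N := by
    intro g₀
    let Ψ : E × E → ℝ := fun y =>
      φ (((extChartAt I (1 : G)).symm y.1)⁻¹ * (extChartAt I g₀).symm y.2)
    have hΨ : ContMDiffAt 𝓘(ℝ, E × E) 𝓘(ℝ, ℝ) ∞ Ψ (extChartAt I (1 : G) 1, extChartAt I g₀ g₀) := by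
      have h1 : ContMDiffAt 𝓘(ℝ, E × E) I ∞ (fun y : E × E => (extChartAt I (1 : G)).symm y.1)
          (extChartAt I (1 : G) 1, extChartAt I g₀ g₀) :=
        ContMDiffAt.comp (I' := 𝓘(ℝ, E)) (g := (extChartAt I (1 : G)).symm)
          (f := (Prod.fst : E × E → E)) _ (hsymm 1) contDiff_fst.contMDiff.contMDiffAt
      have h2 : ContMDiffAt 𝓘(ℝ, E × E) I ∞ (fun y : E × E => (extChartAt I g₀).symm y.2)
          (extChartAt I (1 : G) 1, extChartAt I g₀ g₀) :=
        ContMDiffAt.comp (I' := 𝓘(ℝ, E)) (g := (extChartAt I g₀).symm)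
          (f := (Prod.snd : E × E → E)) _ (hsymm g₀) contDiff_snd.contMDiff.contMDiffAt
      exact hφ.contMDiffAt.comp _ (h1.inv.mul h2)
    obtain ⟨C, t, ht, hC⟩ := (hΨ.contDiffAt.of_le (by simp)).exists_lipschitzOnWith
    rw [nhds_prod_eq] at ht
    obtain ⟨N, hN, M, hM, hNM⟩ := mem_prod_iff.1 ht
    refine ⟨C, N, hN, (extChartAt I g₀).source ∩ extChartAt I g₀ ⁻¹' M,
      inter_mem (extChartAt_source_mem_nhds g₀) (continuousAt_extChartAt g₀ hM), ?_⟩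
    rintro g ⟨hgs, hgM⟩ y hy z hz
    have := hC (hNM (Set.mk_mem_prod hy hgM)) (hNM (Set.mk_mem_prod hz hgM))
    simp only [Ψ, (extChartAt I g₀).left_inv hgs, Prod.edist_eq, edist_self] at this
    simpa using this
  choose C N hN M hM hCNM using hloc
  obtain ⟨t, -, ht⟩ := isCompact_univ.elim_nhds_subcover M fun g _ => hM g
  refine ⟨t.sup C, ⋂ g ∈ t, N g, (biInter_finset_mem t).2 fun g _ => hN g, fun g => ?_⟩
  obtain ⟨g₀, hg₀, hg⟩ := Set.mem_iUnion₂.1 (ht (Set.mem_univ g))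
  exact ((hCNM g₀ g hg).mono (Set.biInter_subset_of_mem hg₀)).weaken (Finset.le_sup hg₀)

open Topology Filter MeasureTheory in
/-- The orbit maps of a continuous finite-dimensional representation of a compact Lie group are
Lipschitz near the identity. -/
theorem exists_lipschitzOnWith_orbitMap {E : Type*} [NormedAddCommGroup E] [NormedSpace ℝ E]
    [FiniteDimensional ℝ E]
    {H : Type*} [TopologicalSpace H] (I : ModelWithCorners ℝ E H) [I.Boundaryless]
    {G : Type*} [Group G] [TopologicalSpace G] [ChartedSpace H G] [LieGroup I ∞ G]
    [CompactSpace G] {W : Type*} [NormedAddCommGroup W] [NormedSpace ℝ W] [FiniteDimensional ℝ W]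
    (ρ : Representation ℝ G W) (hρ : Continuous fun x : G × W => ρ x.1 x.2) (v : W) :
    ∃ C : NNReal, ∃ N ∈ 𝓝 (extChartAt I (1 : G) 1),
      LipschitzOnWith C (fun y => ρ ((extChartAt I (1 : G)).symm y) v) N := by
  have : IsTopologicalGroup G := topologicalGroup_of_lieGroup I ∞
  have : T2Space G := t2Space_of_lieGroup I
  have : CompleteSpace W := FiniteDimensional.complete ℝ W
  let _ : MeasurableSpace G := borel G
  have : BorelSpace G := ⟨rfl⟩
  let e := extChartAt I (1 : G)
  let μ : Measure G := Measure.haar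
  -- The vectors with the desired property form a subspace, closed by finite dimension, so
  -- approximating `v` by such vectors suffices.
  let Good : Submodule ℝ W :=
    { carrier := {v | ∃ C : NNReal, ∃ N ∈ 𝓝 (e 1), LipschitzOnWith C (fun y => ρ (e.symm y) v) N}
      zero_mem' := ⟨0, Set.univ, univ_mem, by simp⟩
      add_mem' := by
        rintro a b ⟨C, N, hN, hC⟩ ⟨C', N', hN', hC'⟩
        refine ⟨C + C', N ∩ N', inter_mem hN hN', ?_⟩
        simpa using (hC.mono Set.inter_subset_left).add (hC'.mono Set.inter_subset_right)
      smul_mem' := by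
        rintro c a ⟨C, N, hN, hC⟩
        refine ⟨‖c‖₊ * C, N, hN, ?_⟩
        simp only [map_smul]
        exact (lipschitzWith_smul c).comp_lipschitzOnWith hC }
  suffices h : v ∈ Good from h
  have horb : ∀ v, Continuous fun g => ρ g v := fun v =>
    hρ.comp (continuous_id.prodMk continuous_const)
  have hint : ∀ {f : G → W}, Continuous f → Integrable f μ := fun hf =>
    hf.integrable_of_hasCompactSupport (HasCompactSupport.of_compactSpace _)
  have hint_smul : ∀ {φ : G → ℝ}, Continuous φ → Integrable (fun g => φ g • ρ g v) μ := fun hφ =>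
    hint (hφ.smul (horb v))
  have hsmooth : ∀ φ : G → ℝ, ContMDiff I 𝓘(ℝ, ℝ) ∞ φ → ∫ g, φ g • ρ g v ∂μ ∈ Good := by
    intro φ hφ
    obtain ⟨C, N, hN, hC⟩ := exists_lipschitzOnWith_translate I hφ
    have hφc : Continuous φ := hφ.continuous
    have hint' : ∀ h : G, Integrable (fun g => φ (h⁻¹ * g) • ρ g v) μ := fun h =>
      hint ((hφc.comp (continuous_const.mul continuous_id)).smul (horb v))
    -- Invariance of Haar measure moves `h` from the merely continuous action onto the smooth weight
    -- `φ`.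
    have htrans : ∀ h : G, ρ h (∫ g, φ g • ρ g v ∂μ) = ∫ g, φ (h⁻¹ * g) • ρ g v ∂μ := by
      intro h
      rw [← integral_mul_left_eq_self (fun g => φ (h⁻¹ * g) • ρ g v) h]
      have := (LinearMap.toContinuousLinearMap (ρ h)).integral_comp_comm
        (hint_smul hφc)
      rw [LinearMap.coe_toContinuousLinearMap'] at this
      rw [← this]
      simp
    obtain ⟨B, hB⟩ : ∃ B, ∀ g, ‖ρ g v‖ ≤ B := by
      obtain ⟨B, hB⟩ := isCompact_univ.exists_bound_of_continuousOn (horb v).continuousOn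
      exact ⟨B, fun g => hB g (Set.mem_univ g)⟩
    have hB0 : 0 ≤ B := (norm_nonneg _).trans (hB 1)
    refine ⟨Real.toNNReal (C * B * μ.real Set.univ), N, hN,
      LipschitzOnWith.of_dist_le_mul fun y hy z hz => ?_⟩
    rw [htrans, htrans, dist_eq_norm, ← integral_sub (hint' _) (hint' _),
      Real.coe_toNNReal _ (by positivity)]
    refine (norm_integral_le_of_norm_le_const (C := C * dist y z * B)
      (.of_forall fun g => ?_)).trans (le_of_eq (by ring))
    rw [← sub_smul, norm_smul]
    have := (hC g).dist_le_mul y hy z hz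
    rw [dist_eq_norm] at this
    exact mul_le_mul this (hB g) (norm_nonneg _) (by positivity)
  have hclosed : IsClosed (Good : Set W) := Good.closed_of_finiteDimensional
  rw [← SetLike.mem_coe, ← hclosed.closure_eq, Metric.mem_closure_iff]
  intro ε hε
  have hnear : {g : G | dist (ρ g v) v < ε / 2} ∈ 𝓝 (1 : G) := by
    have : ContinuousAt (fun g => dist (ρ g v) v) (1 : G) :=
      ((horb v).dist continuous_const).continuousAt
    exact this.eventually (Iio_mem_nhds (by simpa using half_pos hε))
  -- A bump supported where `ρ g v` is within `ε / 2` of `v`: the normalized average is then as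
  -- close to `v`.
  obtain ⟨φ, hφ, -⟩ := (SmoothBumpFunction.nhds_basis_support (I := I) hnear).mem_iff.1 hnear
  have hφs : ContMDiff I 𝓘(ℝ, ℝ) ∞ φ := φ.contMDiff
  have hφc : Continuous φ := φ.continuous
  have hφi : Integrable φ μ :=
    hφc.integrable_of_hasCompactSupport (HasCompactSupport.of_compactSpace _)
  have hpos : 0 < ∫ g, φ g ∂μ :=
    hφc.integral_pos_of_hasCompactSupport_nonneg_nonzero (HasCompactSupport.of_compactSpace _)
      (fun _ => φ.nonneg) (x := 1) (by rw [φ.eq_one]; exact one_ne_zero)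
  refine ⟨(∫ g, φ g ∂μ)⁻¹ • ∫ g, φ g • ρ g v ∂μ, Good.smul_mem _ (hsmooth φ hφs), ?_⟩
  have hdiff : ‖∫ g, φ g • (ρ g v - v) ∂μ‖ ≤ (∫ g, φ g ∂μ) * (ε / 2) := by
    rw [← integral_mul_const]
    refine norm_integral_le_of_norm_le (hφi.mul_const _) (.of_forall fun g => ?_)
    rw [norm_smul, Real.norm_of_nonneg φ.nonneg]
    by_cases hg : φ g = 0
    · simp [hg]
    · refine mul_le_mul_of_nonneg_left ?_ φ.nonneg
      rw [← dist_eq_norm]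
      exact le_of_lt (hφ (subset_tsupport _ hg))
  have hsplit : ∫ g, φ g • (ρ g v - v) ∂μ = (∫ g, φ g • ρ g v ∂μ) - (∫ g, φ g ∂μ) • v := by
    simp_rw [smul_sub]
    rw [integral_sub (hint_smul hφc) (hφi.smul_const v),
      integral_smul_const]
  have heq : (∫ g, φ g ∂μ)⁻¹ • ∫ g, φ g • ρ g v ∂μ - v =
      (∫ g, φ g ∂μ)⁻¹ • ∫ g, φ g • (ρ g v - v) ∂μ := by
    rw [hsplit, smul_sub, inv_smul_smul₀ hpos.ne']
  rw [dist_comm, dist_eq_norm, heq, norm_smul, norm_inv, Real.norm_of_nonneg hpos.le]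
  calc _ ≤ (∫ g, φ g ∂μ)⁻¹ * ((∫ g, φ g ∂μ) * (ε / 2)) := by gcongr
    _ = ε / 2 := inv_mul_cancel_left₀ hpos.ne' _
    _ < ε := half_lt_self hε

open Topology Filter in
/-- The orbits of a continuous finite-dimensional representation of a compact Lie group have
Hausdorff dimension at most the dimension of the group. -/
theorem dimH_orbit_le {E : Type*} [NormedAddCommGroup E] [NormedSpace ℝ E]
    [FiniteDimensional ℝ E]
    {H : Type*} [TopologicalSpace H] (I : ModelWithCorners ℝ E H) [I.Boundaryless]
    {G : Type*} [Group G] [TopologicalSpace G] [ChartedSpace H G] [LieGroup I ∞ G]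
    [CompactSpace G] {W : Type*} [NormedAddCommGroup W] [NormedSpace ℝ W] [FiniteDimensional ℝ W]
    (ρ : Representation ℝ G W) (hρ : Continuous fun x : G × W => ρ x.1 x.2) (v : W) :
    dimH (Set.range fun g => ρ g v) ≤ Module.finrank ℝ E := by
  have : IsTopologicalGroup G := topologicalGroup_of_lieGroup I ∞
  obtain ⟨C, N, hN, hC⟩ := exists_lipschitzOnWith_orbitMap I ρ hρ v
  let e := extChartAt I (1 : G)
  let U : Set G := e.source ∩ e ⁻¹' N
  have hU : U ∈ 𝓝 (1 : G) :=
    inter_mem (extChartAt_source_mem_nhds 1) (continuousAt_extChartAt 1 hN)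
  have hUdim : dimH ((fun g => ρ g v) '' U) ≤ Module.finrank ℝ E := by
    have hsub : (fun g => ρ g v) '' U ⊆ (fun y => ρ (e.symm y) v) '' N := by
      rintro _ ⟨g, ⟨hg, hgN⟩, rfl⟩
      exact ⟨e g, hgN, by simp only [e.left_inv hg]⟩
    calc dimH ((fun g => ρ g v) '' U) ≤ dimH N := (dimH_mono hsub).trans hC.dimH_image_le
      _ ≤ dimH (Set.univ : Set E) := dimH_mono (Set.subset_univ _)
      _ = Module.finrank ℝ E := Real.dimH_univ_eq_finrank E
  -- Finitely many left translates of `U` cover `G`, and each `ρ g` is Lipschitz, so the bound near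
  -- the identity extends to the whole orbit.
  obtain ⟨t, -, ht⟩ := isCompact_univ.elim_nhds_subcover (fun g : G => (g⁻¹ * ·) ⁻¹' U)
    fun g _ => (continuous_const.mul continuous_id).continuousAt (by simpa using hU)
  have hcover : (Set.range fun g => ρ g v) ⊆ ⋃ g ∈ (t : Set G), ρ g '' ((fun g => ρ g v) '' U) := by
    rintro _ ⟨h, rfl⟩
    obtain ⟨g, hg, hgU⟩ := Set.mem_iUnion₂.1 (ht (Set.mem_univ h))
    refine Set.mem_iUnion₂.2 ⟨g, hg, _, ⟨g⁻¹ * h, hgU, rfl⟩, ?_⟩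
    rw [← Module.End.mul_apply, ← map_mul, mul_inv_cancel_left]
  refine (dimH_mono hcover).trans ?_
  rw [dimH_bUnion t.countable_toSet]
  exact iSup₂_le fun g _ =>
    ((LinearMap.toContinuousLinearMap (ρ g)).lipschitz.dimH_image_le _).trans hUdim

/-! ### Separation of orbits and the final count -/

theorem contDiff_comp_of_mem_polyFun {V W : Type*} [AddCommGroup V] [Module ℝ V]
    [NormedAddCommGroup W] [NormedSpace ℝ W] [FiniteDimensional ℝ W] (L : W →ₗ[ℝ] V)
    {f : V → ℝ} (hf : f ∈ polyFun V) : ContDiff ℝ 1 (f ∘ L) := by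
  refine Algebra.adjoin_induction (p := fun f _ => ContDiff ℝ 1 (f ∘ L)) ?_ ?_ ?_ ?_ hf
  · rintro f ⟨φ, hφ⟩
    have : f ∘ L = LinearMap.toContinuousLinearMap (φ ∘ₗ L) := funext fun w => hφ (L w)
    rw [this]
    exact ContinuousLinearMap.contDiff _
  · exact fun r => contDiff_const
  · exact fun f g _ _ hf hg => hf.add hg
  · exact fun f g _ _ hf hg => hf.mul hg

/-- The indicator of the orbit of `v` factors through `S`, so it takes the value `1` at `w` as well.
-/
theorem IsFunctionBasis.exists_apply_eq {G V : Type*} [Group G] [AddCommGroup V] [Module ℝ V]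
    {ρ : Representation ℝ G V} {S : Set (V → ℝ)} (hS : IsFunctionBasis ρ S) {v w : V}
    (h : ∀ p ∈ S, p w = p v) : ∃ g, ρ g v = w := by
  classical
  obtain ⟨F, hF⟩ := hS.2 (Set.indicator (Set.range fun g => ρ g v) 1) fun g u => by
    have : ρ g u ∈ (Set.range fun g => ρ g v) ↔ u ∈ (Set.range fun g => ρ g v) := by
      constructor
      · rintro ⟨k, hk⟩
        refine ⟨g⁻¹ * k, ?_⟩
        simp only [map_mul, Module.End.mul_apply] at hk ⊢
        rw [hk, ρ.inv_self_apply]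
      · rintro ⟨k, rfl⟩
        exact ⟨g * k, by simp⟩
    simp only [Set.indicator_apply, this, Pi.one_apply]
  have hv : v ∈ Set.range fun g => ρ g v := ⟨1, by simp⟩
  have heq : Set.indicator (Set.range fun g => ρ g v) (1 : V → ℝ) w =
      Set.indicator (Set.range fun g => ρ g v) 1 v := by
    rw [hF, hF]
    exact congrArg F (funext fun p => h p p.2)
  rw [Set.indicator_of_mem hv] at heq
  by_contra hw
  change w ∉ Set.range fun g => ρ g v at hw
  rw [Set.indicator_of_notMem hw] at heq
  exact zero_ne_one heq

theorem theorem3p2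
    -- a compact Lie group `G` of dimension `d`
    {E : Type*} [NormedAddCommGroup E] [NormedSpace ℝ E] [FiniteDimensional ℝ E]
    {H : Type*} [TopologicalSpace H] (I : ModelWithCorners ℝ E H) [I.Boundaryless]
    {G : Type*} [Group G] [TopologicalSpace G] [ChartedSpace H G] [LieGroup I ∞ G]
    [CompactSpace G]
    (d : ℕ) (hd : Module.finrank ℝ E = d)
    -- a real vector space `V` of dimension `n > d`, with its canonical topology
    {V : Type*} [AddCommGroup V] [Module ℝ V] [FiniteDimensional ℝ V]
    [TopologicalSpace V] [IsTopologicalAddGroup V] [ContinuousSMul ℝ V] [T2Space V]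
    (n : ℕ) (hn : Module.finrank ℝ V = n) (hdn : d < n)
    -- a continuous linear action of `G` on `V`
    (ρ : Representation ℝ G V) (hρ : Continuous fun x : G × V => ρ x.1 x.2)
    (S : Set (V → ℝ)) (hS : IsPolynomialFunctionBasis ρ S) :
    ((n - d : ℕ) : ℕ∞) ≤ S.encard := by
  rcases S.finite_or_infinite with hfin | hinf
  swap
  · rw [hinf.encard_eq]; exact le_top
  have := hfin.fintype
  -- Hausdorff dimension needs a metric and `V` carries only a topology, so the action is
  -- transported to coordinates.
  let W := Fin n → ℝ
  have hW : Module.finrank ℝ W = n := by simp [W]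
  let L : W ≃L[ℝ] V := ContinuousLinearEquiv.ofFinrankEq (hW.trans hn.symm)
  let σ : Representation ℝ G W :=
    { toFun := fun g => L.symm.toLinearEquiv.conj (ρ g)
      map_one' := by ext; simp
      map_mul' := fun g h => by ext; simp }
  have hσ_apply : ∀ g w, σ g w = L.symm (ρ g (L w)) := fun g w => rfl
  have hσ : Continuous fun x : G × W => σ x.1 x.2 := by
    simp only [hσ_apply]
    exact L.symm.continuous.comp (hρ.comp (continuous_fst.prodMk (L.continuous.comp continuous_snd)))
  obtain ⟨v₀, hv₀⟩ := exists_finrank_le_dimH_fiber (p := fun (p : S) => (p : V → ℝ) ∘ L)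
    fun p => contDiff_comp_of_mem_polyFun L.toLinearMap (hS.1 p.2).1
  have hsub : {w | ∀ p : S, ((p : V → ℝ) ∘ L) w = ((p : V → ℝ) ∘ L) v₀} ⊆
      Set.range fun g => σ g v₀ := by
    intro w hw
    obtain ⟨g, hg⟩ := hS.2.exists_apply_eq (v := L v₀) (w := L w) fun p hp => hw ⟨p, hp⟩
    exact ⟨g, by simp only [hσ_apply, hg, L.symm_apply_apply]⟩
  have hle := hv₀.trans (add_le_add_left ((dimH_mono hsub).trans (dimH_orbit_le I σ hσ v₀)) _)
  rw [hW, hd, ← Nat.cast_add, Nat.cast_le] at hle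
  rw [Set.encard_eq_coe_toFinset_card, Set.toFinset_card, Nat.cast_le]
  omega
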